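/- Let $p\ge 1$. A $p$-Ferrer diagram is a set of boxes labelled by $p$-tuples of positive integers, defined inductively: a $1$-Ferrer diagram is $\{1,\dots,\lambda\}$ with $\lambda\ge 1$; if $\lambda_1\supseteq\lambda_2\supseteq\dots\supseteq\lambda_m$ ($m\ge 1$) are $p$-Ferrer diagrams, then $\{(\eta,i) : 1\le i\le m,\ \eta\in\lambda_i\}$ is a $(p+1)$-Ferrer diagram. Let $\Phi$ be a $p$-Ferrer diagram, $K$ a field, and $S=K[x_i^{(k)} : 1\le k\le p,\ 1\le i\le N_k]$ a polynomial ring with $N_k\ge \alpha_k$ for all $(\alpha_1,\dots,\alpha_p)\in\Phi$ and all $k$; put $n=\dim S=\sum_k N_k$. Let $\mathcal I_\Phi\subset S$ be the ideal generated by the monomials $x_{\alpha_1}^{(1)}x_{\alpha_2}^{(2)}\cdots x_{\alpha_p}^{(p)}$ with $(\alpha_1,\dots,\alpha_p)\in\Phi$. For $k\ge 1$ the $k$-diagonal of $\Phi$ is the set of $\alpha\in\Phi$ with $\alpha_1+\dots+\alpha_p-p+1=k$; let $s_\Phi(k)$ be its number of elements. The $k$-diagonal is called full if $s_\Phi(k)=\binom{k-1+p-1}{p-1}$.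 Let $\delta(\Phi)$ be the number of nonempty diagonals of $\Phi$. Theorem. Let $c=\operatorname{ht}\mathcal I_\Phi$, $d=n-c$, and for $1\le i\le d$ let $s_{d-i}=s_\Phi(c+i)$ be the number of elements in the $(c+i)$-diagonal of $\Phi$. Then: 1. $c$ is equal to the number of full diagonals of $\Phi$. 2. For every $j\ge 1$, the $j$-th Betti number of $S/\mathcal I_\Phi$ (the rank of the $j$-th module in a minimal graded free resolution of $S/\mathcal I_\Phi$ over $S$) is $$\beta_j(S/\mathcal I_\Phi)=\binom{c+p-1}{j+p-1}\binom{j+p-2}{p-1}+\sum_{i=0}^{d-1}s_i\binom{n-i-1}{j-1}.$$ 3. $\operatorname{projdim}(S/\mathcal I_\Phi)=\delta(\Phi)$. -/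

import Mathlib

/-- `p`-Ferrer diagrams, as sets of boxes labelled by `p`-tuples of positive integers, `p ≥ 1`.
A `1`-Ferrer diagram is `{1, …, l}` with `l ≥ 1`. A `(p+1)`-Ferrer diagram is given by a sequence
`lam_1 ≥ … ≥ lam_m`, `m ≥ 1`, of `p`-Ferrer diagrams, ordered by inclusion of their sets of boxes,
and consists of the boxes `(η, i)` with `1 ≤ i ≤ m` and `η ∈ lam_i`.
(The index `i : Fin m` below stands for the slice number `i + 1`.) -/
inductive IsFerrerDiagram : (p : ℕ) → Set (Fin p → ℕ) → Prop
  | one (l : ℕ) (hl : 1 ≤ l) : IsFerrerDiagram 1 {a | 1 ≤ a 0 ∧ a 0 ≤ l}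
  | succ (p m : ℕ) (hm : 1 ≤ m) (lam : Fin m → Set (Fin p → ℕ))
      (hlam : ∀ i, IsFerrerDiagram p (lam i))
      (hanti : ∀ i j, i ≤ j → lam j ⊆ lam i) :
      IsFerrerDiagram (p + 1)
        {a | ∃ i : Fin m, ∃ η ∈ lam i, a = Fin.snoc (α := fun _ => ℕ) η ((i : ℕ) + 1)}

/-- The variables: for each `k = 1, …, p` (here `k : Fin p`) the finite list
`x_1^{(k)}, …, x_{N k}^{(k)}`; the pair `⟨k, i⟩` stands for `x_{i+1}^{(k+1)}`. -/
abbrev FerrerVar {p : ℕ} (N : Fin p → ℕ) : Type := Σ k : Fin p, Fin (N k)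

/-- The polynomial ring `S` in the variables `x_i^{(k)}`, `1 ≤ k ≤ p`, `1 ≤ i ≤ N k`. -/
abbrev FerrerRing {p : ℕ} (K : Type*) [Field K] (N : Fin p → ℕ) : Type _ :=
  MvPolynomial (FerrerVar N) K

/-- The ideal `I_Φ` generated by the monomials `x_{a_1}^{(1)} ⋯ x_{a_p}^{(p)}`, where
`(a_1, …, a_p)` runs over the boxes of `Φ`. It is used only when all these variables lie in the
ring, that is, when `a k ≤ N k` for every box `a` of `Φ`. -/
noncomputable def ferrerIdeal {p : ℕ} (K : Type*) [Field K] (N : Fin p → ℕ) (Φ : Set (Fin p → ℕ)) :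
    Ideal (FerrerRing K N) :=
  Ideal.span {f | ∃ v : (k : Fin p) → Fin (N k),
    (fun k => (v k : ℕ) + 1) ∈ Φ ∧ f = ∏ k, MvPolynomial.X ⟨k, v k⟩}

/-- The `k`-diagonal of `Φ`: the boxes `a` with `a_1 + ⋯ + a_p - p + 1 = k`. -/
def ferrerDiagonal {p : ℕ} (Φ : Set (Fin p → ℕ)) (k : ℕ) : Set (Fin p → ℕ) :=
  {a ∈ Φ | ∑ t, a t + 1 = k + p}

/-- `s_Φ(k)`, the number of elements of the `k`-diagonal of `Φ`. -/
noncomputable def diagonalCard {p : ℕ} (Φ : Set (Fin p → ℕ)) (k : ℕ) : ℕ :=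
  (ferrerDiagonal Φ k).ncard

/-- The number of full diagonals of `Φ`: the `k`-diagonal (`k ≥ 1`) is full when it has
`C(k - 1 + p - 1, p - 1)` elements. -/
noncomputable def fullDiagonals {p : ℕ} (Φ : Set (Fin p → ℕ)) : ℕ :=
  {k : ℕ | 1 ≤ k ∧ diagonalCard Φ k = ((k - 1) + (p - 1)).choose (p - 1)}.ncard

/-- `δ(Φ)`, the number of (non-empty) diagonals of `Φ`. -/
noncomputable def numDiagonals {p : ℕ} (Φ : Set (Fin p → ℕ)) : ℕ :=
  {k : ℕ | 1 ≤ k ∧ (ferrerDiagonal Φ k).Nonempty}.ncard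

/-- A minimal graded free resolution
`⋯ → S^{rank 2} → S^{rank 1} → S^{rank 0} → S/I → 0` of `S/I`, where `S = K[σ]` has the standard
grading. The basis element `c` of `S^{rank j}` has degree `deg j c`, the maps are given by the
matrices `d j` with homogeneous entries, and minimality means that all the entries lie in the
irrelevant maximal ideal. -/
structure MinimalGradedFreeResolution {σ K : Type*} [Field K]
    (I : Ideal (MvPolynomial σ K)) where
  rank : ℕ → ℕ
  deg : (j : ℕ) → Fin (rank j) → ℕ
  d : (j : ℕ) → Matrix (Fin (rank j)) (Fin (rank (j + 1))) (MvPolynomial σ K)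
  aug : (Fin (rank 0) → MvPolynomial σ K) →ₗ[MvPolynomial σ K] (MvPolynomial σ K ⧸ I)
  aug_surjective : Function.Surjective aug
  exact_aug : Function.Exact (d 0).mulVecLin aug
  exact_d : ∀ j, Function.Exact (d (j + 1)).mulVecLin (d j).mulVecLin
  aug_homogeneous : ∀ r, ∃ f : MvPolynomial σ K,
    f.IsHomogeneous (deg 0 r) ∧ aug (Pi.single r 1) = Ideal.Quotient.mk I f
  d_homogeneous : ∀ j r c, d j r c = 0 ∨
    ∃ e : ℕ, deg (j + 1) c = deg j r + e ∧ (d j r c).IsHomogeneous e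
  minimal : ∀ j r c, MvPolynomial.constantCoeff (d j r c) = 0

/-- `β_j(S/I) = b`: the module `S/I` has a minimal graded free resolution, and the `j`-th free
module of any such resolution has rank `b`. -/
def IsBettiNumber {σ K : Type*} [Field K] (I : Ideal (MvPolynomial σ K)) (j b : ℕ) : Prop :=
  Nonempty (MinimalGradedFreeResolution I) ∧
    ∀ F : MinimalGradedFreeResolution I, F.rank j = b

/-! Count labels from zero, so that a box `v` lies on the diagonal |v| + 1, where |v| = ∑ v_k. A
Ferrer diagram is closed under lowering coordinates, so it can be built by adding one box at a time,
each box `v` being maximal among those present. The colon of the ideal of the earlier boxes by the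
monomial of `v` is then generated by the |v| variables with label below v_k in some direction k
(`boxMonomial_mul_mem_iff`). These are linear quotients: the mapping cone
(`LinearResolution.exists_cone`) of a Koszul-type resolution of the colon ideal adds C(|v|, j) to
the j-th rank of a linear resolution. Entries of positive degree make the resolution minimal, and
ranks of minimal resolutions are unique (`MinimalGradedFreeResolution.rank_eq`), so β_{j+1}(S/I) =
∑_v C(|v|, j).

Grouping the boxes by diagonals, the full diagonals sum to the closed binomial term and the others
give the sum over s_i. The last nonzero rank sits at max |v| + 1 = δ(Φ), which is therefore the
projective dimension.

For the height, the full diagonals form an initial segment 1, …, c. A box missing from the diagonal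
c + 1 yields a prime generated by c variables that contains I. Conversely, a prime containing I
contains an initial run of t_k variables in each direction k, with (t_k + 1)_k not in Φ; this forces
∑ t_k ≥ c. -/

open MvPolynomial Matrix

universe u

/-! ### Linear resolutions and mapping cones -/

/-- Multiplication by a homogeneous polynomial shifts homogeneous components. -/
theorem MvPolynomial.homogeneousComponent_mul_of_isHomogeneous {σ R : Type*} [CommSemiring R]
    {a : MvPolynomial σ R} {e : ℕ} (ha : a.IsHomogeneous e) (f : MvPolynomial σ R) (k : ℕ) :
    homogeneousComponent (e + k) (a * f) = a * homogeneousComponent k f := by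
  conv_lhs => rw [← sum_homogeneousComponent f, Finset.mul_sum, map_sum]
  have h : ∀ i, homogeneousComponent (e + k) (a * homogeneousComponent i f) =
      if i = k then a * homogeneousComponent k f else 0 := by
    intro i
    rw [homogeneousComponent_of_mem (ha.mul (homogeneousComponent_isHomogeneous i f))]
    by_cases hik : i = k
    · simp [hik]
    · rw [if_neg (by omega), if_neg hik]
  simp only [h, Finset.sum_ite_eq', Finset.mem_range]
  split_ifs with hk
  · rfl
  · rw [homogeneousComponent_eq_zero _ _ (by omega), mul_zero]

/-- If the columns of a homogeneous matrix lie in the range of another one,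
then it factors through a homogeneous matrix. -/
theorem exists_homogeneous_factor {σ R : Type*} [CommRing R] {α β γ : Type*} [Fintype β]
    [Fintype γ] {A : Matrix α β (MvPolynomial σ R)} {B : Matrix α γ (MvPolynomial σ R)} {e k : ℕ}
    (hA : ∀ r c, (A r c).IsHomogeneous e) (hB : ∀ r c, (B r c).IsHomogeneous (e + k))
    (h : ∀ v, ∃ w, A *ᵥ w = B *ᵥ v) :
    ∃ W : Matrix β γ (MvPolynomial σ R), (∀ r c, (W r c).IsHomogeneous k) ∧ A * W = B := by
  classical
  choose w hw using fun c => h (Pi.single c 1)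
  -- Only the degree `k` part of a preimage contributes in degree `e + k`, so truncating an
  -- arbitrary preimage keeps the equation.
  refine ⟨Matrix.of fun r c => homogeneousComponent k (w c r),
    fun r c => homogeneousComponent_isHomogeneous _ _, ?_⟩
  ext1 r c
  have h1 : ∑ s, A r s * w c s = B r c := by
    have := congrFun (hw c) r
    rw [mulVec_single_one] at this
    exact this
  have h2 := congrArg (homogeneousComponent (e + k)) h1
  rw [map_sum, homogeneousComponent_of_mem (hB r c), if_pos rfl] at h2
  rw [← h2, mul_apply]
  exact Finset.sum_congr rfl fun s _ =>
    (homogeneousComponent_mul_of_isHomogeneous (hA r s) _ _).symm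

/-- A linear free resolution of an ideal generated in degree `q`: the row `gen` lists generators
of degree `q`, and all the other maps are given by matrices of linear forms. -/
structure LinearResolution {σ K : Type*} [Field K] (q : ℕ) (I : Ideal (MvPolynomial σ K)) where
  ι : ℕ → Type
  fintype : ∀ j, Fintype (ι j)
  gen : Matrix Unit (ι 0) (MvPolynomial σ K)
  d : ∀ j, Matrix (ι j) (ι (j + 1)) (MvPolynomial σ K)
  mem_iff : ∀ f, f ∈ I ↔ ∃ v, gen *ᵥ v = fun _ => f
  exact_gen : ∀ v, gen *ᵥ v = 0 ↔ ∃ w, d 0 *ᵥ w = v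
  exact_d : ∀ j v, d j *ᵥ v = 0 ↔ ∃ w, d (j + 1) *ᵥ w = v
  gen_homogeneous : ∀ r c, (gen r c).IsHomogeneous q
  d_homogeneous : ∀ j r c, (d j r c).IsHomogeneous 1

attribute [instance] LinearResolution.fintype

namespace LinearResolution

variable {σ K : Type*} [Field K] {q : ℕ} {I P : Ideal (MvPolynomial σ K)}

/-- The rank of the `j`-th free module. -/
def rank (F : LinearResolution q I) (j : ℕ) : ℕ := Fintype.card (F.ι j)

theorem gen_mul_d (F : LinearResolution q I) : F.gen * F.d 0 = 0 := by
  classical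
  apply Matrix.ext_of_mulVec_single
  intro i
  rw [← mulVec_mulVec, (F.exact_gen _).2 ⟨_, rfl⟩, zero_mulVec]

theorem d_mul_d (F : LinearResolution q I) (j : ℕ) : F.d j * F.d (j + 1) = 0 := by
  classical
  apply Matrix.ext_of_mulVec_single
  intro i
  rw [← mulVec_mulVec, (F.exact_d _ _).2 ⟨_, rfl⟩, zero_mulVec]

/-- The resolution of the zero ideal. -/
noncomputable def bot (q : ℕ) : LinearResolution q (⊥ : Ideal (MvPolynomial σ K)) where
  ι _ := Empty
  fintype _ := inferInstance
  gen := 0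
  d _ := 0
  mem_iff f := by simp [funext_iff, eq_comm]
  exact_gen v := by simp [eq_iff_true_of_subsingleton]
  exact_d j v := by simp [eq_iff_true_of_subsingleton]
  gen_homogeneous _ c := c.elim
  d_homogeneous _ r := r.elim

theorem rank_bot (q j : ℕ) :
    (bot q : LinearResolution q (⊥ : Ideal (MvPolynomial σ K))).rank j = 0 :=
  Fintype.card_empty

/-- Multiplication by `m` lifts to a comparison map of linear resolutions whose entries are linear
forms. -/
theorem exists_comparison (F : LinearResolution q I) (G : LinearResolution 1 P)
    {m : MvPolynomial σ K} (hm : m.IsHomogeneous q) (hmP : ∀ f ∈ P, m * f ∈ I) :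
    ∃ φ : ∀ j, Matrix (F.ι j) (G.ι j) (MvPolynomial σ K),
      (∀ j r c, (φ j r c).IsHomogeneous 1) ∧ F.gen * φ 0 = m • G.gen ∧
      ∀ j, F.d j * φ (j + 1) = φ j * G.d j := by
  classical
  -- The invariant of the recursion: linear entries, and liftability of the next square along `F.d
  -- j`.
  let Q (j : ℕ) (φ : Matrix (F.ι j) (G.ι j) (MvPolynomial σ K)) : Prop :=
    (∀ r c, (φ r c).IsHomogeneous 1) ∧ ∀ v, ∃ w, F.d j *ᵥ w = (φ * G.d j) *ᵥ v
  obtain ⟨φ₀, hφ₀, hgen⟩ : ∃ φ₀, Q 0 φ₀ ∧ F.gen * φ₀ = m • G.gen := by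
    obtain ⟨W, hW, hW'⟩ := exists_homogeneous_factor (B := m • G.gen) (k := 1) F.gen_homogeneous
      (fun r c => hm.mul (G.gen_homogeneous r c)) (fun v => by
        obtain ⟨w, hw⟩ := (F.mem_iff _).1 (hmP _ ((G.mem_iff ((G.gen *ᵥ v) ())).2 ⟨v, rfl⟩))
        exact ⟨w, by rw [hw, smul_mulVec]; rfl⟩)
    refine ⟨W, ⟨hW, fun v => (F.exact_gen _).1 ?_⟩, hW'⟩
    rw [mulVec_mulVec, ← Matrix.mul_assoc, hW', smul_mul, G.gen_mul_d, smul_zero, zero_mulVec]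
  have step : ∀ j (φ : {φ // Q j φ}), ∃ ψ : {ψ // Q (j + 1) ψ}, F.d j * ψ.1 = φ.1 * G.d j := by
    rintro j ⟨φ, hφ, h⟩
    obtain ⟨W, hW, hW'⟩ := exists_homogeneous_factor (B := φ * G.d j) (k := 1) (F.d_homogeneous j)
      (fun r c => IsHomogeneous.sum _ _ _ fun s _ => (hφ r s).mul (G.d_homogeneous j s c)) h
    refine ⟨⟨W, hW, fun v => (F.exact_d _ _).1 ?_⟩, hW'⟩
    rw [mulVec_mulVec, ← Matrix.mul_assoc, hW', Matrix.mul_assoc, G.d_mul_d, Matrix.mul_zero,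
      zero_mulVec]
  choose next hnext using step
  let φ : ∀ j, {φ // Q j φ} := fun j => Nat.rec ⟨φ₀, hφ₀⟩ next j
  exact ⟨fun j => (φ j).1, fun j => (φ j).2.1, hgen, fun j => hnext j (φ j)⟩

/-- The hypothesis says A₁(x + φ₂z) = 0, so x + φ₂z = A₂w, and (w, -z) is a preimage in the cone.
This one chase serves every position of the cone. -/
theorem cone_exact {R : Type*} [CommRing R] {α β γ δ ε : Type*} [Fintype β] [Fintype γ]
    [Fintype δ] [Fintype ε] {A₁ : Matrix α β R} {A₂ : Matrix β γ R} {φ₁ : Matrix α δ R}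
    {φ₂ : Matrix β ε R} {B : Matrix δ ε R} (hA : ∀ v, A₁ *ᵥ v = 0 ↔ ∃ w, A₂ *ᵥ w = v)
    (hφ : A₁ * φ₂ = φ₁ * B) {x : β → R} {z : ε → R}
    (h : A₁ *ᵥ x + φ₁ *ᵥ (B *ᵥ z) = 0) :
    ∃ w, fromBlocks A₂ φ₂ 0 (-B) *ᵥ (Sum.elim w (-z)) = Sum.elim x (B *ᵥ z) := by
  obtain ⟨w, hw⟩ := (hA (x + φ₂ *ᵥ z)).1 (by
    rw [mulVec_add, mulVec_mulVec, hφ, ← mulVec_mulVec, h])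
  refine ⟨w, ?_⟩
  rw [fromBlocks_mulVec, Sum.elim_comp_inl, Sum.elim_comp_inr, hw, mulVec_neg, zero_mulVec,
    neg_mulVec, mulVec_neg, neg_neg, zero_add, add_neg_cancel_right]

/-- The mapping cone: adding a generator `m` of degree `q` with linear colon ideal `P`. -/
theorem exists_cone (F : LinearResolution q I) (G : LinearResolution 1 P)
    {m : MvPolynomial σ K} (hm : m.IsHomogeneous q) (hmP : ∀ f, m * f ∈ I ↔ f ∈ P) :
    ∃ C : LinearResolution q (I ⊔ Ideal.span {m}), C.rank 0 = F.rank 0 + 1 ∧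
      ∀ j, C.rank (j + 1) = F.rank (j + 1) + G.rank j := by
  obtain ⟨φ, hφ, hgen, hd⟩ := F.exists_comparison G hm fun f => (hmP f).2
  -- Position `j + 1` of the cone is F_{j+1} ⊕ G_j; the `Unit` in position 0 is the new generator
  -- `m`.
  let ι : ℕ → Type := fun j => Nat.casesOn j (F.ι 0 ⊕ Unit) fun j => F.ι (j + 1) ⊕ G.ι j
  let fin : ∀ j, Fintype (ι j) := fun j =>
    Nat.casesOn j (inferInstanceAs (Fintype (F.ι 0 ⊕ Unit)))
      fun j => inferInstanceAs (Fintype (F.ι (j + 1) ⊕ G.ι j))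
  let d : ∀ j, Matrix (ι j) (ι (j + 1)) (MvPolynomial σ K) := fun j =>
    Nat.casesOn j (fromBlocks (F.d 0) (φ 0) 0 (-G.gen))
      fun j => fromBlocks (F.d (j + 1)) (φ (j + 1)) 0 (-G.d j)
  let M : Matrix Unit Unit (MvPolynomial σ K) := Matrix.of fun _ _ => m
  have hM : F.gen * φ 0 = M * G.gen := by
    rw [hgen]; ext; simp [M, Matrix.mul_apply]
  refine ⟨{ ι := ι, fintype := fin, d := d, gen := (fromCols F.gen M : Matrix Unit (F.ι 0 ⊕ Unit) _)
            mem_iff := ?_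
            exact_gen := ?_
            exact_d := ?_
            gen_homogeneous := ?_
            d_homogeneous := ?_ }, ?_, ?_⟩
  · intro f
    have key : f ∈ I ⊔ Ideal.span {m} ↔ ∃ x y, F.gen *ᵥ x + M *ᵥ y = fun _ => f := by
      rw [Submodule.mem_sup]
      constructor
      · rintro ⟨g, hg, h, hh, rfl⟩
        obtain ⟨x, hx⟩ := (F.mem_iff g).1 hg
        obtain ⟨a, rfl⟩ := Ideal.mem_span_singleton'.1 hh
        refine ⟨x, fun _ => a, ?_⟩
        rw [hx]
        ext1
        simp [M, mulVec, dotProduct, mul_comm]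
      · rintro ⟨x, y, h⟩
        refine ⟨(F.gen *ᵥ x) (), (F.mem_iff _).2 ⟨x, rfl⟩, (M *ᵥ y) (), ?_, congrFun h ()⟩
        exact Ideal.mem_span_singleton'.2 ⟨y (), by simp [M, mulVec, dotProduct, mul_comm]⟩
    rw [key]
    constructor
    · rintro ⟨x, y, h⟩
      exact ⟨Sum.elim x y, by rw [← h]; exact fromCols_mulVec_sumElim _ _ _ _⟩
    · rintro ⟨v, h⟩
      exact ⟨v ∘ Sum.inl, v ∘ Sum.inr, by rw [← h]; exact (fromCols_mulVec _ _ _).symm⟩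
  · intro v
    constructor
    · intro h
      have h' : F.gen *ᵥ (v ∘ Sum.inl) + M *ᵥ (v ∘ Sum.inr) = 0 :=
        (fromCols_mulVec _ _ _).symm.trans h
      -- The coefficient of `m` in a syzygy lies in the colon ideal `P`, hence comes from `G.gen`.
      have hv : m * v (Sum.inr ()) ∈ I := by
        refine (F.mem_iff _).2 ⟨-(v ∘ Sum.inl), ?_⟩
        rw [mulVec_neg, neg_eq_of_add_eq_zero_right h']
        ext1
        simp [M, mulVec, dotProduct]
      obtain ⟨z, hz⟩ := (G.mem_iff _).1 ((hmP _).1 hv)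
      have hz' : G.gen *ᵥ z = v ∘ Sum.inr := hz
      rw [← hz'] at h'
      obtain ⟨w, hw⟩ := cone_exact F.exact_gen hM h'
      refine ⟨Sum.elim w (-z), hw.trans ?_⟩
      rw [hz']
      exact Sum.elim_comp_inl_inr v
    · rintro ⟨w, rfl⟩
      refine (mulVec_mulVec (m := Unit) (n := F.ι 0 ⊕ Unit) (o := F.ι 1 ⊕ G.ι 0) w _ _).trans ?_
      have : fromCols F.gen M * fromBlocks (F.d 0) (φ 0) 0 (-G.gen) = 0 := by
        rw [fromCols_mul_fromBlocks, F.gen_mul_d, hM]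
        simp
      exact (congrArg (· *ᵥ w) this).trans (zero_mulVec w)
  · have key : ∀ (j : ℕ) {α : Type} [Fintype α] (B : Matrix α (G.ι j) (MvPolynomial σ K)),
        (∀ v, B *ᵥ v = 0 ↔ ∃ w, G.d j *ᵥ w = v) → F.d j * φ (j + 1) = φ j * G.d j →
        ∀ v, fromBlocks (F.d j) (φ j) 0 (-B) *ᵥ v = 0 ↔
          ∃ w, fromBlocks (F.d (j + 1)) (φ (j + 1)) 0 (-G.d j) *ᵥ w = v := by
      intro j α _ B hB hφd v
      constructor
      · intro h
        rw [fromBlocks_mulVec] at h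
        have h1 := congrArg (· ∘ Sum.inl) h
        have h2 := congrArg (· ∘ Sum.inr) h
        simp only [Sum.elim_comp_inl, Sum.elim_comp_inr, zero_mulVec, zero_add, neg_mulVec] at h1 h2
        obtain ⟨z, hz⟩ := (hB _).1 (neg_eq_zero.1 h2)
        rw [← hz] at h1
        obtain ⟨w, hw⟩ := cone_exact (F.exact_d j) hφd h1
        refine ⟨Sum.elim w (-z), hw.trans ?_⟩
        rw [hz]
        exact Sum.elim_comp_inl_inr v
      · rintro ⟨w, rfl⟩
        have hBG : B * G.d j = 0 := by
          classical
          apply Matrix.ext_of_mulVec_single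
          intro i
          rw [← mulVec_mulVec, (hB _).2 ⟨_, rfl⟩, zero_mulVec]
        rw [mulVec_mulVec, fromBlocks_multiply, F.d_mul_d, hφd]
        simp [hBG]
    rintro (_ | j) v
    · exact key 0 G.gen G.exact_gen (hd 0) v
    · exact key (j + 1) (G.d j) (G.exact_d j) (hd (j + 1)) v
  · rintro r (c | c)
    · exact F.gen_homogeneous r c
    · exact hm
  · rintro (_ | j) (r | r) (c | c)
    · exact F.d_homogeneous 0 r c
    · exact hφ 0 r c
    · exact isHomogeneous_zero _ _ _
    · exact (G.gen_homogeneous r c).neg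
    · exact F.d_homogeneous (j + 1) r c
    · exact hφ (j + 1) r c
    · exact isHomogeneous_zero _ _ _
    · exact (G.d_homogeneous j r c).neg
  · exact Fintype.card_sum
  · intro j
    exact Fintype.card_sum

end LinearResolution

/-! ### Primes generated by variables: resolution and height -/

section VariableIdeals

variable {σ K : Type*} [Field K]

/-- Killing the variables in `T`. -/
noncomputable def killVariables (K : Type*) [Field K] (T : Finset σ) :
    MvPolynomial σ K →ₐ[K] MvPolynomial σ K := by
  classical exact aeval fun i => if i ∈ T then 0 else X i

/-- The ideal generated by the variables in `T`. -/
noncomputable def variableIdeal (K : Type*) [Field K] (T : Finset σ) : Ideal (MvPolynomial σ K) :=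
  Ideal.span (X '' (T : Set σ))

/-- Killing the variables of `T` is the identity modulo the ideal they generate. As the kernel of a
map to a domain, this ideal is prime. -/
theorem mem_variableIdeal_iff {T : Finset σ} {f : MvPolynomial σ K} :
    f ∈ variableIdeal K T ↔ killVariables K T f = 0 := by
  classical
  constructor
  · intro hf
    have : variableIdeal K T ≤ RingHom.ker (killVariables K T) := by
      refine Ideal.span_le.2 ?_
      rintro _ ⟨i, hi, rfl⟩
      simp [killVariables, Finset.mem_coe.1 hi]
    exact this hf
  · intro hf
    have h : (Ideal.Quotient.mkₐ K (variableIdeal K T)).comp (killVariables K T) =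
        Ideal.Quotient.mkₐ K (variableIdeal K T) := by
      ext i
      by_cases hi : i ∈ T
      · have hX : (X i : MvPolynomial σ K) ∈ variableIdeal K T :=
          Ideal.subset_span ⟨i, hi, rfl⟩
        simp [killVariables, hi, Ideal.Quotient.eq_zero_iff_mem.2 hX]
      · simp [killVariables, hi]
    have := DFunLike.congr_fun h f
    rw [AlgHom.comp_apply, hf, map_zero] at this
    exact Ideal.Quotient.eq_zero_iff_mem.1 this.symm

instance variableIdeal_isPrime (T : Finset σ) : (variableIdeal K T).IsPrime := by
  have : variableIdeal K T = RingHom.ker (killVariables K T) :=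
    Ideal.ext fun f => mem_variableIdeal_iff
  rw [this]
  exact RingHom.ker_isPrime _

theorem X_mem_variableIdeal_iff {T : Finset σ} {i : σ} :
    (X i : MvPolynomial σ K) ∈ variableIdeal K T ↔ i ∈ T := by
  rw [mem_variableIdeal_iff]
  simp [killVariables]

theorem variableIdeal_insert [DecidableEq σ] (T : Finset σ) (t : σ) :
    variableIdeal K (insert t T) = variableIdeal K T ⊔ Ideal.span {X t} := by
  rw [variableIdeal, variableIdeal, ← Ideal.span_union, Finset.coe_insert, Set.image_insert_eq,
    Set.union_singleton]

/-- A new variable is a nonzerodivisor modulo the prime generated by the old ones, so the colon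
ideal is that prime itself; the cone of `G` with itself reproduces Pascal's rule. -/
theorem exists_linearResolution_variableIdeal (T : Finset σ) :
    ∃ G : LinearResolution 1 (variableIdeal K T), ∀ j, G.rank j = T.card.choose (j + 1) := by
  classical
  induction T using Finset.induction_on with
  | empty =>
    have : variableIdeal K (∅ : Finset σ) = ⊥ := by simp [variableIdeal]
    rw [this]
    exact ⟨.bot 1, fun j => by simpa using LinearResolution.rank_bot 1 j⟩
  | insert t T ht ih =>
    obtain ⟨G, hG⟩ := ih
    have hX : (X t : MvPolynomial σ K) ∉ variableIdeal K T := mt X_mem_variableIdeal_iff.1 ht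
    obtain ⟨C, h0, hs⟩ := G.exists_cone G (isHomogeneous_X K t) fun f =>
      ⟨fun h => ((variableIdeal_isPrime T).mem_or_mem h).resolve_left hX,
        fun h => Ideal.mul_mem_left _ _ h⟩
    rw [variableIdeal_insert]
    refine ⟨C, ?_⟩
    rw [Finset.card_insert_of_notMem ht]
    rintro (_ | j)
    · rw [h0, hG, zero_add, Nat.choose_one_right, Nat.choose_one_right]
    · rw [hs, hG, hG, Nat.choose_succ_succ T.card, add_comm]

/-- Adding variables one at a time gives a strict chain of primes. -/
theorem card_le_height_variableIdeal (T : Finset σ) :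
    (T.card : ℕ∞) ≤ (variableIdeal K T).height := by
  classical
  induction T using Finset.induction_on with
  | empty => simp
  | insert t T ht ih =>
    have hlt : variableIdeal K T < variableIdeal K (insert t T) := by
      refine lt_of_le_of_ne (by rw [variableIdeal_insert]; exact le_sup_left) fun h => ht ?_
      rw [← X_mem_variableIdeal_iff (K := K), h, X_mem_variableIdeal_iff]
      exact Finset.mem_insert_self t T
    rw [Finset.card_insert_of_notMem ht]
    push_cast
    exact (add_le_add_left ih 1).trans (Ideal.height_add_one_le_of_lt_of_isPrime hlt)

/-- Krull's height theorem, the prime being minimal over itself. -/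
theorem height_variableIdeal_le [Finite σ] (T : Finset σ) :
    (variableIdeal K T).height ≤ T.card := by
  have h := Ideal.height_le_card_of_mem_minimalPrimes_span (p := variableIdeal K T)
    (T.finite_toSet.image X) (by
      change _ ∈ (variableIdeal K T).minimalPrimes
      rw [Ideal.minimalPrimes_eq_subsingleton_self]
      rfl)
  refine h.trans (Nat.cast_le.2 ?_)
  have := Set.ncard_image_le (f := (X : σ → MvPolynomial σ K)) T.finite_toSet
  rwa [Set.ncard_coe_finset] at this

end VariableIdeals

/-! ### Linear quotients for lower sets of boxes -/

section BoxIdeals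

variable {p : ℕ} {N : Fin p → ℕ} (K : Type*) [Field K]

/-- The monomial attached to a box, with labels counted from zero. -/
noncomputable def boxMonomial (v : (k : Fin p) → Fin (N k)) : FerrerRing K N :=
  ∏ k, X ⟨k, v k⟩

/-- The ideal generated by the monomials of a set of boxes. -/
noncomputable def boxIdeal (A : Finset ((k : Fin p) → Fin (N k))) : Ideal (FerrerRing K N) :=
  Ideal.span (boxMonomial K '' (A : Set ((k : Fin p) → Fin (N k))))

/-- The variables whose label is smaller than the one of the box `v` in the same direction. -/
def smallerVars (v : (k : Fin p) → Fin (N k)) : Finset (FerrerVar N) :=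
  Finset.univ.sigma fun k => Finset.Iio (v k)

theorem mem_smallerVars {v : (k : Fin p) → Fin (N k)} {t : FerrerVar N} :
    t ∈ smallerVars v ↔ t.2 < v t.1 := by
  simp [smallerVars]

theorem card_smallerVars (v : (k : Fin p) → Fin (N k)) :
    (smallerVars v).card = ∑ k, (v k : ℕ) := by
  simp [smallerVars]

theorem boxMonomial_isHomogeneous (v : (k : Fin p) → Fin (N k)) :
    (boxMonomial K v).IsHomogeneous p := by
  have := IsHomogeneous.prod (R := K) Finset.univ (fun k => X (⟨k, v k⟩ : FerrerVar N))
    (fun _ => 1) fun k _ => isHomogeneous_X K _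
  rw [Finset.sum_const, Finset.card_univ, Fintype.card_fin, smul_eq_mul, mul_one] at this
  exact this

/-- Every `w` in `A` is smaller than `v` in some direction, so its monomial lies in the prime of
`smallerVars v`, which does not contain the monomial of `v`. Conversely, a smaller variable can be
exchanged for the one of `v` in the same direction, producing the monomial of a box below `v`. -/
theorem boxMonomial_mul_mem_iff {A : Finset ((k : Fin p) → Fin (N k))}
    {v : (k : Fin p) → Fin (N k)} (hA : ∀ w < v, w ∈ A) (hv : ∀ w ∈ A, ¬ v ≤ w)
    (f : FerrerRing K N) :
    boxMonomial K v * f ∈ boxIdeal K A ↔ f ∈ variableIdeal K (smallerVars v) := by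
  constructor
  · intro h
    have hle : boxIdeal K A ≤ variableIdeal K (smallerVars v) := by
      refine Ideal.span_le.2 ?_
      rintro _ ⟨w, hw, rfl⟩
      obtain ⟨k, hk⟩ := not_forall.1 (hv w hw)
      refine Ideal.mem_of_dvd _ (Finset.dvd_prod_of_mem _ (Finset.mem_univ k)) ?_
      exact X_mem_variableIdeal_iff.2 (mem_smallerVars.2 (not_le.1 hk))
    refine ((variableIdeal_isPrime _).mem_or_mem (hle h)).resolve_left fun hm => ?_
    obtain ⟨k, -, hk⟩ := (variableIdeal_isPrime _).prod_mem_iff.1 hm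
    exact lt_irrefl _ (mem_smallerVars.1 (X_mem_variableIdeal_iff.1 hk))
  · intro h
    have hle : variableIdeal K (smallerVars v) ≤
        Submodule.comap (LinearMap.mulLeft (FerrerRing K N) (boxMonomial K v)) (boxIdeal K A) := by
      refine Submodule.span_le.2 ?_
      rintro _ ⟨⟨k, i⟩, hi, rfl⟩
      have hi : i < v k := mem_smallerVars.1 hi
      have hw : boxMonomial K (Function.update v k i) ∈ boxIdeal K A :=
        Ideal.subset_span ⟨_, hA _ (update_lt_self_iff.2 hi), rfl⟩
      have heq : boxMonomial K v * X ⟨k, i⟩ =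
          X ⟨k, v k⟩ * boxMonomial K (Function.update v k i) := by
        have h : ∏ j ∈ Finset.univ.erase k, (X ⟨j, Function.update v k i j⟩ : FerrerRing K N) =
            ∏ j ∈ Finset.univ.erase k, X ⟨j, v j⟩ :=
          Finset.prod_congr rfl fun j hj => by
            rw [Function.update_of_ne (Finset.ne_of_mem_erase hj)]
        have h1 := Finset.mul_prod_erase Finset.univ
          (fun j => (X ⟨j, v j⟩ : FerrerRing K N)) (Finset.mem_univ k)
        have h2 := Finset.mul_prod_erase Finset.univ
          (fun j => (X ⟨j, Function.update v k i j⟩ : FerrerRing K N)) (Finset.mem_univ k)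
        simp only [Function.update_self] at h2
        rw [boxMonomial, boxMonomial, ← h1, ← h2, h]
        ring
      change boxMonomial K v * X ⟨k, i⟩ ∈ boxIdeal K A
      rw [heq]
      exact Ideal.mul_mem_left _ _ hw
    exact hle h

/-- Removing a maximal box leaves a lower set, and restoring it is a cone over the resolution of |v|
variables. It contributes 1 = C(|v|, 0) in position 0 and C(|v|, j + 1) in position `j + 1`. -/
theorem exists_linearResolution_boxIdeal (A : Finset ((k : Fin p) → Fin (N k)))
    (hA : IsLowerSet (A : Set ((k : Fin p) → Fin (N k)))) :
    ∃ F : LinearResolution p (boxIdeal K A),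
      ∀ j, F.rank j = ∑ v ∈ A, (∑ k, (v k : ℕ)).choose j := by
  classical
  induction hn : A.card generalizing A with
  | zero =>
    obtain rfl := Finset.card_eq_zero.1 hn
    have : boxIdeal K (∅ : Finset ((k : Fin p) → Fin (N k))) = ⊥ := by simp [boxIdeal]
    rw [this]
    exact ⟨.bot p, fun j => by simpa using LinearResolution.rank_bot p j⟩
  | succ n ih =>
    obtain ⟨v, hv⟩ := A.exists_maximal (Finset.card_pos.1 (by omega))
    have hlow : IsLowerSet ((A.erase v : Finset _) : Set ((k : Fin p) → Fin (N k))) := by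
      intro a b hba ha
      have ha := Finset.mem_erase.1 (Finset.mem_coe.1 ha)
      refine Finset.mem_coe.2 (Finset.mem_erase.2 ⟨?_, hA hba ha.2⟩)
      rintro rfl
      exact ha.1 (hv.eq_of_ge ha.2 hba)
    obtain ⟨F, hF⟩ := ih (A.erase v) hlow (by rw [Finset.card_erase_of_mem hv.prop, hn]; rfl)
    obtain ⟨G, hG⟩ := exists_linearResolution_variableIdeal (K := K) (smallerVars v)
    obtain ⟨C, h0, hs⟩ := F.exists_cone G (boxMonomial_isHomogeneous K v)
      (boxMonomial_mul_mem_iff K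
        (fun w hw => Finset.mem_erase.2 ⟨hw.ne, hA hw.le hv.prop⟩)
        fun w hw hvw => (Finset.mem_erase.1 hw).1 (hv.eq_of_ge (Finset.mem_erase.1 hw).2 hvw))
    have hI : boxIdeal K A = boxIdeal K (A.erase v) ⊔ Ideal.span {boxMonomial K v} := by
      rw [boxIdeal, boxIdeal, ← Ideal.span_union, Set.union_singleton, ← Set.image_insert_eq,
        ← Finset.coe_insert, Finset.insert_erase hv.prop]
    rw [hI]
    refine ⟨C, ?_⟩
    rintro (_ | j)
    · rw [h0, hF, ← Finset.sum_erase_add _ _ hv.prop, Nat.choose_zero_right (∑ k, (v k : ℕ))]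
    · rw [hs, hF, hG, card_smallerVars, ← Finset.sum_erase_add _ _ hv.prop]

end BoxIdeals

/-- A map of modules with finite free source factors through another such map as soon as its
range is contained in the range of the latter. -/
theorem Matrix.exists_mul_eq {R α β γ : Type*} [CommRing R] [Fintype β] [Fintype γ]
    {A : Matrix α β R} {B : Matrix α γ R} (h : ∀ v, ∃ w, A *ᵥ w = B *ᵥ v) :
    ∃ W : Matrix β γ R, A * W = B := by
  classical
  choose w hw using fun c => h (Pi.single c 1)
  refine ⟨Matrix.of fun r c => w c r, ?_⟩
  ext1 r c
  have := congrFun (hw c) r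
  rw [mulVec_single_one] at this
  exact this

/-! ### Projective dimension read off from a minimal resolution -/

section ProjectiveDimension

open CategoryTheory

variable {R M : Type u} [CommRing R] [AddCommGroup M] [Module R M]

/-- The cover of the kernel of the augmentation of an exact complex of free modules. -/
theorem exists_shifted_augmentation {r : ℕ → ℕ} {D : ∀ j, Matrix (Fin (r j)) (Fin (r (j + 1))) R}
    {aug : (Fin (r 0) → R) →ₗ[R] M} (h0 : Function.Exact (D 0).mulVecLin aug)
    (hD : ∀ j, Function.Exact (D (j + 1)).mulVecLin (D j).mulVecLin) :
    ∃ aug' : (Fin (r 1) → R) →ₗ[R] LinearMap.ker aug, Function.Surjective aug' ∧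
      Function.Exact (D 1).mulVecLin aug' := by
  refine ⟨(D 0).mulVecLin.codRestrict _ fun x => (h0 _).2 ⟨x, rfl⟩, ?_, ?_⟩
  · rintro ⟨y, hy⟩
    obtain ⟨x, hx⟩ := (h0 y).1 hy
    exact ⟨x, Subtype.ext hx⟩
  · intro x
    rw [← hD 0 x, ← Subtype.coe_inj]
    rfl

/-- Dimension shifting: the shifted complex resolves the first syzygy module. -/
theorem hasProjectiveDimensionLT_of_rank_eq_zero (n : ℕ) {M : Type u} [AddCommGroup M] [Module R M]
    {r : ℕ → ℕ} {D : ∀ j, Matrix (Fin (r j)) (Fin (r (j + 1))) R}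
    {aug : (Fin (r 0) → R) →ₗ[R] M} (hsurj : Function.Surjective aug)
    (h0 : Function.Exact (D 0).mulVecLin aug)
    (hD : ∀ j, Function.Exact (D (j + 1)).mulVecLin (D j).mulVecLin) (hn : r n = 0) :
    HasProjectiveDimensionLT (ModuleCat.of R M) n := by
  induction n generalizing M r with
  | zero =>
    rw [hasProjectiveDimensionLT_zero_iff_isZero, ModuleCat.isZero_of_iff_subsingleton]
    have : IsEmpty (Fin (r 0)) := by rw [hn]; infer_instance
    exact hsurj.subsingleton
  | succ n ih =>
    obtain ⟨aug', hsurj', h0'⟩ := exists_shifted_augmentation h0 hD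
    have hker := ih (r := fun j => r (j + 1)) (D := fun j => D (j + 1)) hsurj' h0'
      (fun j => hD (j + 1)) hn
    have hS := LinearMap.shortExact_shortComplexKer hsurj
    have : Projective (ModuleCat.of R (Fin (r 0) → R)) :=
      ModuleCat.projective_of_categoryTheory_projective _
    exact hS.hasProjectiveDimensionLT_X₃ n hker
      (hasProjectiveDimensionLT_of_ge (ModuleCat.of R (Fin (r 0) → R)) 1 (n + 1) (by omega))

/-- Passing to syzygies reduces to `M` zero or projective. There a contraction expresses the
identity through the differentials, which vanish under `ε`, so a free module of positive rank is
impossible. -/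
theorem rank_eq_zero_of_hasProjectiveDimensionLT {k : Type*} [Field k] (ε : R →+* k) (n : ℕ)
    {M : Type u} [AddCommGroup M] [Module R M]
    {r : ℕ → ℕ} {D : ∀ j, Matrix (Fin (r j)) (Fin (r (j + 1))) R}
    {aug : (Fin (r 0) → R) →ₗ[R] M} (hsurj : Function.Surjective aug)
    (h0 : Function.Exact (D 0).mulVecLin aug)
    (hD : ∀ j, Function.Exact (D (j + 1)).mulVecLin (D j).mulVecLin)
    (hmin : ∀ j, (D j).map ε = 0)
    (h : HasProjectiveDimensionLT (ModuleCat.of R M) n) : r n = 0 := by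
  have empty_of_one : ∀ {m : ℕ}, (1 : Matrix (Fin m) (Fin m) k) = 0 → m = 0 := by
    intro m h1
    by_contra hm
    have := congrFun (congrFun h1 ⟨0, Nat.pos_of_ne_zero hm⟩) ⟨0, Nat.pos_of_ne_zero hm⟩
    simp at this
  induction n using Nat.twoStepInduction generalizing M r with
  | zero =>
    rw [hasProjectiveDimensionLT_zero_iff_isZero, ModuleCat.isZero_of_iff_subsingleton] at h
    obtain ⟨W, hW⟩ := Matrix.exists_mul_eq (A := D 0)
      (B := (1 : Matrix (Fin (r 0)) (Fin (r 0)) R)) fun v =>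
      (h0 _).1 (Subsingleton.elim _ _)
    have := congrArg (fun A => A.map ε) hW
    rw [Matrix.map_mul, hmin, Matrix.zero_mul, Matrix.map_one ε (map_zero ε) (map_one ε)] at this
    exact empty_of_one this.symm
  | one =>
    have : Projective (ModuleCat.of R M) := inferInstance
    have : Module.Projective R M := (IsProjective.iff_projective M).2 this
    -- A splitting `s` of `aug` gives 1 - s∘aug = D₀W, hence D₀WD₀ = D₀ and WD₀ - 1 = D₁V. Applying
    -- `ε` leaves -1 = 0 in rank `r 1`.
    obtain ⟨s, hs⟩ := Module.projective_lifting_property aug LinearMap.id hsurj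
    obtain ⟨W, hW⟩ := Matrix.exists_mul_eq (A := D 0)
      (B := 1 - LinearMap.toMatrix' (s ∘ₗ aug)) fun v => by
        refine (h0 _).1 ?_
        have := LinearMap.congr_fun hs (aug v)
        rw [sub_mulVec, one_mulVec, LinearMap.toMatrix'_mulVec, map_sub, LinearMap.comp_apply,
          sub_eq_zero]
        exact this.symm
    have hW' : D 0 * W * D 0 = D 0 := by
      apply Matrix.ext_of_mulVec_single
      intro i
      have : aug (D 0 *ᵥ Pi.single i 1) = 0 := (h0 _).2 ⟨_, rfl⟩
      rw [← mulVec_mulVec, hW, sub_mulVec, one_mulVec, LinearMap.toMatrix'_mulVec,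
        LinearMap.comp_apply, this, map_zero, sub_zero]
    obtain ⟨V, hV⟩ := Matrix.exists_mul_eq (A := D 1) (B := W * D 0 - 1) fun v => by
      refine (hD 0 _).1 ?_
      rw [mulVecLin_apply, mulVec_mulVec, Matrix.mul_sub, ← Matrix.mul_assoc, hW', Matrix.mul_one,
        sub_self, zero_mulVec]
    have := congrArg (fun A => A.map ε) hV
    rw [Matrix.map_mul, hmin, Matrix.zero_mul, Matrix.map_sub ε (map_sub ε), Matrix.map_mul, hmin,
      Matrix.mul_zero, Matrix.map_one ε (map_zero ε) (map_one ε), zero_sub] at this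
    exact empty_of_one (neg_eq_zero.1 this.symm)
  | more n _ ih =>
    obtain ⟨aug', hsurj', h0'⟩ := exists_shifted_augmentation h0 hD
    have hS := LinearMap.shortExact_shortComplexKer hsurj
    have : Projective (ModuleCat.of R (Fin (r 0) → R)) :=
      ModuleCat.projective_of_categoryTheory_projective _
    exact ih (r := fun j => r (j + 1)) (D := fun j => D (j + 1)) hsurj' h0' (fun j => hD (j + 1))
      (fun j => hmin (j + 1)) ((hS.hasProjectiveDimensionLT_X₃_iff n this).1 h)

end ProjectiveDimension

/-! ### Uniqueness of the ranks of minimal resolutions -/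

namespace MinimalGradedFreeResolution

variable {σ K : Type*} [Field K] {I : Ideal (MvPolynomial σ K)}

theorem d_map_constantCoeff (F : MinimalGradedFreeResolution I) (j : ℕ) :
    (F.d j).map constantCoeff = 0 :=
  Matrix.ext fun r c => F.minimal j r c

theorem d_mul_d (F : MinimalGradedFreeResolution I) (j : ℕ) : F.d j * F.d (j + 1) = 0 := by
  apply Matrix.ext_of_mulVec_single
  intro i
  rw [← mulVec_mulVec, zero_mulVec]
  exact (F.exact_d j _).2 ⟨_, rfl⟩

theorem exists_eq_d_mul (F : MinimalGradedFreeResolution I) (j : ℕ) {γ : Type*} [Fintype γ]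
    {A : Matrix (Fin (F.rank (j + 1))) γ (MvPolynomial σ K)} (h : F.d j * A = 0) :
    ∃ B : Matrix (Fin (F.rank (j + 2))) γ (MvPolynomial σ K), F.d (j + 1) * B = A :=
  Matrix.exists_mul_eq fun v => (F.exact_d j _).1 (by
    rw [mulVecLin_apply, mulVec_mulVec, h, zero_mulVec])

/-- In each degree, two comparison maps between minimal resolutions are mutually inverse up to a
map `u` that vanishes modulo the variables and a map that factors through the differential. -/
theorem exists_comparison (F G : MinimalGradedFreeResolution I) (j : ℕ) :
    ∃ (f : Matrix (Fin (G.rank j)) (Fin (F.rank j)) (MvPolynomial σ K))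
      (g : Matrix (Fin (F.rank j)) (Fin (G.rank j)) (MvPolynomial σ K)),
      (∃ f' : Matrix (Fin (G.rank (j + 1))) (Fin (F.rank (j + 1))) (MvPolynomial σ K),
        G.d j * f' = f * F.d j) ∧
      (∃ g' : Matrix (Fin (F.rank (j + 1))) (Fin (G.rank (j + 1))) (MvPolynomial σ K),
        F.d j * g' = g * G.d j) ∧
      (∃ (h : Matrix (Fin (F.rank (j + 1))) (Fin (F.rank j)) (MvPolynomial σ K))
          (u : Matrix (Fin (F.rank j)) (Fin (F.rank j)) (MvPolynomial σ K)),
          g * f = 1 + u + F.d j * h ∧ u * F.d j = 0 ∧ u.map constantCoeff = 0) ∧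
      ∃ (h : Matrix (Fin (G.rank (j + 1))) (Fin (G.rank j)) (MvPolynomial σ K))
          (u : Matrix (Fin (G.rank j)) (Fin (G.rank j)) (MvPolynomial σ K)),
          f * g = 1 + u + G.d j * h ∧ u * G.d j = 0 ∧ u.map constantCoeff = 0 := by
  induction j with
  | zero =>
    have lift : ∀ F G : MinimalGradedFreeResolution I,
        ∃ f : Matrix (Fin (G.rank 0)) (Fin (F.rank 0)) (MvPolynomial σ K),
          ∀ v, G.aug (f *ᵥ v) = F.aug v := by
      intro F G
      obtain ⟨f, hf⟩ := Module.projective_lifting_property G.aug F.aug G.aug_surjective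
      exact ⟨LinearMap.toMatrix' f, fun v => by
        rw [LinearMap.toMatrix'_mulVec, ← hf, LinearMap.comp_apply]⟩
    have chain : ∀ (F G : MinimalGradedFreeResolution I)
        (f : Matrix (Fin (G.rank 0)) (Fin (F.rank 0)) (MvPolynomial σ K)),
        (∀ v, G.aug (f *ᵥ v) = F.aug v) →
        ∃ f' : Matrix (Fin (G.rank 1)) (Fin (F.rank 1)) (MvPolynomial σ K), G.d 0 * f' = f * F.d 0 := fun F G f hf =>
      Matrix.exists_mul_eq fun v => (G.exact_aug _).1 (by
        rw [← mulVec_mulVec, hf]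
        exact (F.exact_aug _).2 ⟨v, rfl⟩)
    have homotopy : ∀ (F G : MinimalGradedFreeResolution I)
        (f : Matrix (Fin (G.rank 0)) (Fin (F.rank 0)) (MvPolynomial σ K))
        (g : Matrix (Fin (F.rank 0)) (Fin (G.rank 0)) (MvPolynomial σ K)),
        (∀ v, G.aug (f *ᵥ v) = F.aug v) → (∀ v, F.aug (g *ᵥ v) = G.aug v) →
        ∃ (h : Matrix (Fin (F.rank 1)) (Fin (F.rank 0)) (MvPolynomial σ K))
          (u : Matrix (Fin (F.rank 0)) (Fin (F.rank 0)) (MvPolynomial σ K)),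
          g * f = 1 + u + F.d 0 * h ∧ u * F.d 0 = 0 ∧ u.map constantCoeff = 0 := by
      intro F G f g hf hg
      obtain ⟨h, hh⟩ := Matrix.exists_mul_eq (A := F.d 0) (B := g * f - 1) fun v =>
        (F.exact_aug _).1 (by
          rw [sub_mulVec, map_sub, ← mulVec_mulVec, hg, hf, one_mulVec, sub_self])
      exact ⟨h, 0, by rw [hh, add_zero, add_sub_cancel], Matrix.zero_mul _,
        Matrix.map_zero _ (map_zero _)⟩
    obtain ⟨f, hf⟩ := lift F G
    obtain ⟨g, hg⟩ := lift G F
    exact ⟨f, g, chain F G f hf, chain G F g hg, homotopy F G f g hf hg, homotopy G F g f hg hf⟩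
  | succ j ih =>
    obtain ⟨f, g, ⟨f', hf⟩, ⟨g', hg⟩, ⟨h, u, h₁, h₂, -⟩, ⟨h', u', h₁', h₂', -⟩⟩ := ih
    have homotopy : ∀ (F G : MinimalGradedFreeResolution I)
        (f : Matrix (Fin (G.rank j)) (Fin (F.rank j)) (MvPolynomial σ K))
        (g : Matrix (Fin (F.rank j)) (Fin (G.rank j)) (MvPolynomial σ K))
        (f' : Matrix (Fin (G.rank (j + 1))) (Fin (F.rank (j + 1))) (MvPolynomial σ K))
        (g' : Matrix (Fin (F.rank (j + 1))) (Fin (G.rank (j + 1))) (MvPolynomial σ K))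
        (h : Matrix (Fin (F.rank (j + 1))) (Fin (F.rank j)) (MvPolynomial σ K))
        (u : Matrix (Fin (F.rank j)) (Fin (F.rank j)) (MvPolynomial σ K)),
        G.d j * f' = f * F.d j → F.d j * g' = g * G.d j →
        g * f = 1 + u + F.d j * h → u * F.d j = 0 →
        ∃ (h : Matrix (Fin (F.rank (j + 2))) (Fin (F.rank (j + 1))) (MvPolynomial σ K))
          (u : Matrix (Fin (F.rank (j + 1))) (Fin (F.rank (j + 1))) (MvPolynomial σ K)),
          g' * f' = 1 + u + F.d (j + 1) * h ∧ u * F.d (j + 1) = 0 ∧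
          u.map constantCoeff = 0 := by
      intro F G f g f' g' h u hf hg h₁ h₂
      obtain ⟨k, hk⟩ := F.exists_eq_d_mul j (A := g' * f' - (1 + h * F.d j)) (by
        rw [Matrix.mul_sub, ← Matrix.mul_assoc, hg, Matrix.mul_assoc, hf, ← Matrix.mul_assoc, h₁,
          Matrix.add_mul, Matrix.add_mul, h₂, Matrix.one_mul, Matrix.mul_add, Matrix.mul_one,
          Matrix.mul_assoc, add_zero, sub_self])
      -- The new `u` is the other half of the homotopy: it is killed by the next differential
      -- because d² = 0, and vanishes modulo the variables by minimality.
      refine ⟨k, h * F.d j, by rw [hk, add_sub_cancel], ?_, ?_⟩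
      · rw [Matrix.mul_assoc, F.d_mul_d, Matrix.mul_zero]
      · rw [Matrix.map_mul, F.d_map_constantCoeff, Matrix.mul_zero]
    refine ⟨f', g', G.exists_eq_d_mul j ?_, F.exists_eq_d_mul j ?_,
      homotopy F G f g f' g' h u hf hg h₁ h₂, homotopy G F g f g' f' h' u' hg hf h₁' h₂'⟩
    · rw [← Matrix.mul_assoc, hf, Matrix.mul_assoc, F.d_mul_d, Matrix.mul_zero]
    · rw [← Matrix.mul_assoc, hg, Matrix.mul_assoc, G.d_mul_d, Matrix.mul_zero]

/-- The ranks in a minimal graded free resolution do not depend on the resolution. -/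
theorem rank_eq (F G : MinimalGradedFreeResolution I) (j : ℕ) : F.rank j = G.rank j := by
  obtain ⟨f, g, -, -, ⟨h, u, h₁, -, hu⟩, ⟨h', u', h₁', -, hu'⟩⟩ := exists_comparison F G j
  have key : ∀ (F G : MinimalGradedFreeResolution I)
      (f : Matrix (Fin (G.rank j)) (Fin (F.rank j)) (MvPolynomial σ K))
      (g : Matrix (Fin (F.rank j)) (Fin (G.rank j)) (MvPolynomial σ K))
      (h : Matrix (Fin (F.rank (j + 1))) (Fin (F.rank j)) (MvPolynomial σ K))
      (u : Matrix (Fin (F.rank j)) (Fin (F.rank j)) (MvPolynomial σ K)),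
      g * f = 1 + u + F.d j * h → u.map constantCoeff = 0 →
      g.map constantCoeff * f.map constantCoeff = 1 := by
    intro F G f g h u h₁ hu
    rw [← Matrix.map_mul, h₁, Matrix.map_add _ (map_add _), Matrix.map_add _ (map_add _), hu,
      Matrix.map_mul, F.d_map_constantCoeff, Matrix.zero_mul, add_zero, add_zero,
      Matrix.map_one _ (map_zero _) (map_one _)]
  -- Modulo the variables the comparison maps are mutually inverse matrices over `K`, hence square.
  simpa using Matrix.square_of_invertible _ _ (key F G f g h u h₁ hu) (key G F g f h' u' h₁' hu')

end MinimalGradedFreeResolution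

/-! ### From linear resolutions to minimal graded ones -/

namespace LinearResolution

variable {σ K : Type*} [Field K] {q : ℕ} {I : Ideal (MvPolynomial σ K)}

/-- The minimal graded free resolution of `S ⧸ I` given by a linear resolution of `I`. -/
theorem exists_minimalGradedFreeResolution (F : LinearResolution q I) (hq : 1 ≤ q) :
    ∃ G : MinimalGradedFreeResolution I, ∀ j, G.rank (j + 1) = F.rank j := by
  let e (j : ℕ) : Fin (F.rank j) ≃ F.ι j := (Fintype.equivFin (F.ι j)).symm
  let rank : ℕ → ℕ := fun j => Nat.casesOn j 1 F.rank
  let gen : Matrix (Fin 1) (Fin (F.rank 0)) (MvPolynomial σ K) :=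
    F.gen.submatrix (fun _ => ()) (e 0)
  let D (j : ℕ) : Matrix (Fin (F.rank j)) (Fin (F.rank (j + 1))) (MvPolynomial σ K) :=
    (F.d j).submatrix (e j) (e (j + 1))
  let d : ∀ j, Matrix (Fin (rank j)) (Fin (rank (j + 1))) (MvPolynomial σ K) := fun j =>
    Nat.casesOn j gen D
  let aug : (Fin 1 → MvPolynomial σ K) →ₗ[MvPolynomial σ K] (MvPolynomial σ K ⧸ I) :=
    Submodule.mkQ I ∘ₗ LinearMap.proj 0
  have hconst : ∀ {f : MvPolynomial σ K} {m : ℕ}, f.IsHomogeneous m → 1 ≤ m →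
      constantCoeff f = 0 := by
    intro f m hf hm
    rw [constantCoeff_eq]
    refine hf.coeff_eq_zero ?_
    simp
    omega
  have hgen : ∀ v, gen *ᵥ v = (F.gen *ᵥ (v ∘ (e 0).symm)) ∘ fun _ => () := fun v =>
    submatrix_mulVec_equiv _ _ _ _
  have hD : ∀ j v, D j *ᵥ v = (F.d j *ᵥ (v ∘ (e (j + 1)).symm)) ∘ e j := fun j v =>
    submatrix_mulVec_equiv _ _ _ _
  have hrange : ∀ j v, (∃ w, F.d j *ᵥ w = v ∘ (e j).symm) ↔ ∃ w, D j *ᵥ w = v := by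
    intro j v
    constructor
    · rintro ⟨w, hw⟩
      refine ⟨w ∘ e (j + 1), ?_⟩
      rw [hD, Function.comp_assoc, Equiv.self_comp_symm, Function.comp_id, hw, Function.comp_assoc,
        Equiv.symm_comp_self, Function.comp_id]
    · rintro ⟨w, rfl⟩
      refine ⟨w ∘ (e (j + 1)).symm, ?_⟩
      rw [hD, Function.comp_assoc, Equiv.self_comp_symm, Function.comp_id]
  refine ⟨{ rank := rank
            -- Position 0 is S itself; position `j + 1` is generated in degree `q + j`.
            deg := fun j => Nat.casesOn j (fun _ => 0) fun j _ => q + j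
            d := d
            aug := aug
            aug_surjective := fun y => ?_
            exact_aug := fun y => ?_
            exact_d := fun j y => ?_
            aug_homogeneous := fun r => ⟨1, isHomogeneous_one _ _, ?_⟩
            d_homogeneous := fun j r c => Or.inr ?_
            minimal := fun j r c => ?_ }, fun j => rfl⟩
  · obtain ⟨f, rfl⟩ := Submodule.mkQ_surjective I y
    exact ⟨fun _ => f, rfl⟩
  · have : aug y = 0 ↔ y (0 : Fin 1) ∈ I := Submodule.Quotient.mk_eq_zero I
    refine this.trans ((F.mem_iff _).trans ?_)
    constructor
    · rintro ⟨v, hv⟩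
      refine ⟨v ∘ e 0, (hgen _).trans ?_⟩
      rw [Function.comp_assoc, Equiv.self_comp_symm, Function.comp_id, hv]
      ext i
      rw [Subsingleton.elim i 0]
      rfl
    · rintro ⟨v, rfl⟩
      exact ⟨v ∘ (e 0).symm, funext fun _ => (congrFun (hgen v) 0).symm⟩
  · cases j with
    | zero =>
      change gen *ᵥ y = 0 ↔ ∃ w, D 0 *ᵥ w = y
      rw [← hrange, ← F.exact_gen, hgen]
      exact ⟨fun h => funext fun _ => congrFun h 0, fun h => by rw [h]; rfl⟩
    | succ j =>
      change D j *ᵥ y = 0 ↔ ∃ w, D (j + 1) *ᵥ w = y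
      rw [← hrange, ← F.exact_d, hD]
      exact ⟨fun h => (e j).surjective.injective_comp_right h, fun h => by rw [h]; rfl⟩
  · have hr : r = (0 : Fin 1) := Subsingleton.elim (α := Fin 1) _ _
    subst hr
    change Submodule.mkQ I ((Pi.single 0 1 : Fin 1 → MvPolynomial σ K) 0) = _
    rw [Pi.single_eq_same]
    rfl
  · cases j with
    | zero => exact ⟨q, (zero_add _).symm, F.gen_homogeneous _ _⟩
    | succ j => exact ⟨1, rfl, F.d_homogeneous _ _ _⟩
  · cases j with
    | zero => exact hconst (F.gen_homogeneous _ _) hq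
    | succ j => exact hconst (F.d_homogeneous _ _ _) le_rfl

end LinearResolution

/-! ### Binomial sums and the combinatorics of diagonals -/

/-- Since C(k+P, P)·C(k, j) = C(k+P, j+P)·C(j+P, P), this is the hockey-stick identity times a
constant. -/
theorem Nat.sum_range_choose_mul_choose (P c j : ℕ) :
    ∑ k ∈ Finset.range c, (k + P).choose P * k.choose j =
      (c + P).choose (j + P + 1) * (j + P).choose P := by
  induction c with
  | zero =>
    rw [Finset.sum_range_zero, Nat.choose_eq_zero_of_lt (by omega), zero_mul]
  | succ c ih =>
    have h := Nat.choose_mul (n := c + P) (k := j + P) (s := P) (Nat.le_add_left _ _)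
    rw [Nat.add_sub_cancel, Nat.add_sub_cancel] at h
    rw [Finset.sum_range_succ, ih, ← h, ← add_mul, Nat.add_right_comm c 1 P,
      Nat.choose_succ_succ (c + P) (j + P), add_comm (Nat.choose _ _)]

/-- A bounded set of positive integers that is closed under positive predecessors is an initial
segment. -/
theorem Set.eq_Icc_one_ncard {S : Set ℕ} {n : ℕ} (h1 : ∀ k ∈ S, 1 ≤ k) (hn : ∀ k ∈ S, k ≤ n)
    (hS : ∀ k, 1 ≤ k → k + 1 ∈ S → k ∈ S) : S = Set.Icc 1 S.ncard := by
  classical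
  obtain ⟨m, hm⟩ : ∃ m, S = Set.Icc 1 m := by
    have hex : ∃ m, m + 1 ∉ S := ⟨n, fun h => by have := hn _ h; omega⟩
    refine ⟨Nat.find hex, Set.ext fun k => ⟨fun hk => ⟨h1 k hk, ?_⟩, fun hk => ?_⟩⟩
    · by_contra hlt
      have hdown : ∀ i, Nat.find hex + 1 + i ∈ S → Nat.find hex + 1 ∈ S := by
        intro i
        induction i with
        | zero => exact id
        | succ i ih => exact fun h => ih (hS _ (by omega) h)
      refine Nat.find_spec hex (hdown (k - (Nat.find hex + 1)) ?_)
      rwa [Nat.add_sub_cancel' (by omega)]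
    · have := not_not.1 (Nat.find_min hex (m := k - 1) (by have := hk.1; have := hk.2; omega))
      rwa [Nat.sub_add_cancel hk.1] at this
  have hcard : S.ncard = m := by
    rw [hm, ← Finset.coe_Icc, Set.ncard_coe_finset, Nat.card_Icc, Nat.add_sub_cancel]
  rw [hcard, hm]

namespace IsFerrerDiagram

variable {p : ℕ} {Φ : Set (Fin p → ℕ)}

theorem one_le_dim (h : IsFerrerDiagram p Φ) : 1 ≤ p := by
  cases h <;> omega

theorem one_le (h : IsFerrerDiagram p Φ) : ∀ a ∈ Φ, ∀ k, 1 ≤ a k := by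
  induction h with
  | one l hl =>
    intro a ha k
    rw [Subsingleton.elim k 0]
    exact ha.1
  | succ p m hm lam _ _ ih =>
    rintro _ ⟨i, η, hη, rfl⟩ k
    refine Fin.lastCases ?_ (fun k => ?_) k
    · rw [Fin.snoc_last]
      omega
    · rw [Fin.snoc_castSucc]
      exact ih i η hη k

theorem nonempty (h : IsFerrerDiagram p Φ) : Φ.Nonempty := by
  induction h with
  | one l hl => exact ⟨fun _ => 1, le_rfl, hl⟩
  | succ p m hm lam _ _ ih =>
    obtain ⟨η, hη⟩ := ih ⟨0, hm⟩
    exact ⟨_, ⟨0, hm⟩, η, hη, rfl⟩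

/-- With positivity and nonemptiness, this closure property is all that the rest uses of the
inductive definition. -/
theorem mem_of_le (h : IsFerrerDiagram p Φ) :
    ∀ a ∈ Φ, ∀ b, b ≤ a → (∀ k, 1 ≤ b k) → b ∈ Φ := by
  induction h with
  | one l hl => exact fun a ha b hba hb => ⟨hb 0, (hba 0).trans ha.2⟩
  | succ p m hm lam _ hanti ih =>
    rintro _ ⟨i, η, hη, rfl⟩ b hba hb
    have hlast := hba (Fin.last p)
    replace hlast : b (Fin.last p) ≤ (i : ℕ) + 1 := by rwa [Fin.snoc_last] at hlast
    have hb1 := hb (Fin.last p)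
    have hi := i.isLt
    refine ⟨⟨b (Fin.last p) - 1, by omega⟩, Fin.init b, ?_, ?_⟩
    · refine hanti _ i (Fin.le_def.2 (by change b (Fin.last p) - 1 ≤ i; omega))
        (ih i η hη _ (fun k => ?_) fun k => hb _)
      have := hba k.castSucc
      rwa [Fin.snoc_castSucc] at this
    · rw [Nat.sub_add_cancel hb1, Fin.snoc_init_self]

end IsFerrerDiagram

/-- All the boxes that can lie on the `k`-diagonal. -/
def fullDiagonal (p k : ℕ) : Set (Fin p → ℕ) := {a | (∀ t, 1 ≤ a t) ∧ ∑ t, a t + 1 = k + p}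

theorem fullDiagonal_eq_image (p k : ℕ) :
    fullDiagonal p (k + 1) =
      (fun (f : Fin p →₀ ℕ) t => f t + 1) '' ((Finset.univ.finsuppAntidiag k : Finset (Fin p →₀ ℕ)) : Set (Fin p →₀ ℕ)) := by
  ext a
  constructor
  · rintro ⟨h1, h2⟩
    refine ⟨Finsupp.equivFunOnFinite.symm fun t => a t - 1, ?_, funext fun t => ?_⟩
    · refine Finset.mem_coe.2 (Finset.mem_finsuppAntidiag.2 ⟨?_, Finset.subset_univ _⟩)
      have : ∑ t, a t = ∑ t, (a t - 1) + p := by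
        rw [← Finset.sum_congr rfl fun t _ => Nat.sub_add_cancel (h1 t), Finset.sum_add_distrib]
        simp
      change ∑ t, (a t - 1) = k
      omega
    · exact Nat.sub_add_cancel (h1 t)
  · rintro ⟨f, hf, rfl⟩
    have hf := (Finset.mem_finsuppAntidiag.1 (Finset.mem_coe.1 hf)).1
    refine ⟨fun t => Nat.le_add_left _ _, ?_⟩
    rw [Finset.sum_add_distrib, hf]
    simp
    omega

theorem finite_fullDiagonal (p k : ℕ) : (fullDiagonal p (k + 1)).Finite := by
  rw [fullDiagonal_eq_image]
  exact (Finset.finite_toSet _).image _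

theorem ncard_fullDiagonal {p : ℕ} (hp : 1 ≤ p) (k : ℕ) :
    (fullDiagonal p (k + 1)).ncard = (k + (p - 1)).choose (p - 1) := by
  rw [fullDiagonal_eq_image, Set.ncard_image_of_injective, Set.ncard_coe_finset,
    Finset.card_finsuppAntidiag_nat_eq_choose, Finset.card_univ, Fintype.card_fin,
    show p + k - 1 = k + (p - 1) by omega, Nat.choose_symm_add]
  intro f g h
  ext t
  exact Nat.succ_injective (congrFun h t)

namespace IsFerrerDiagram

variable {p : ℕ} {Φ : Set (Fin p → ℕ)}

theorem diagonal_subset (h : IsFerrerDiagram p Φ) (k : ℕ) :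
    ferrerDiagonal Φ k ⊆ fullDiagonal p k :=
  fun a ha => ⟨h.one_le a ha.1, ha.2⟩

theorem diagonalCard_eq_iff (h : IsFerrerDiagram p Φ) (k : ℕ) :
    diagonalCard Φ (k + 1) = (k + (p - 1)).choose (p - 1) ↔ fullDiagonal p (k + 1) ⊆ Φ := by
  rw [← ncard_fullDiagonal h.one_le_dim, diagonalCard]
  constructor
  · intro hc
    rw [← Set.eq_of_subset_of_ncard_le (h.diagonal_subset (k + 1)) hc.ge (finite_fullDiagonal p k)]
    exact fun a ha => ha.1
  · intro hs
    rw [(h.diagonal_subset (k + 1)).antisymm fun a ha => ⟨hs ha, ha.2⟩]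

/-- Raising one coordinate by 1 moves a box to the next diagonal, and Φ is closed downwards. -/
theorem fullDiagonal_subset_of_succ (h : IsFerrerDiagram p Φ) {k : ℕ}
    (hk : fullDiagonal p (k + 1) ⊆ Φ) : fullDiagonal p k ⊆ Φ := by
  rintro a ⟨h1, h2⟩
  have hp := h.one_le_dim
  let t₀ : Fin p := ⟨0, hp⟩
  have hle : a ≤ a + Pi.single t₀ 1 := fun t => Nat.le_add_right _ _
  refine h.mem_of_le _ (hk ⟨fun t => (h1 t).trans (hle t), ?_⟩) a hle h1
  simp only [Pi.add_apply, Finset.sum_add_distrib, Finset.sum_pi_single', Finset.mem_univ, if_true]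
  omega

/-- A box beyond the first diagonal has a coordinate at least 2, which can be lowered by 1. -/
theorem ferrerDiagonal_nonempty_of_succ (h : IsFerrerDiagram p Φ) {k : ℕ} (hk : 1 ≤ k)
    (hne : (ferrerDiagonal Φ (k + 1)).Nonempty) : (ferrerDiagonal Φ k).Nonempty := by
  obtain ⟨a, ha, hsum⟩ := hne
  obtain ⟨t, ht⟩ : ∃ t, 2 ≤ a t := by
    by_contra! hlt
    have : ∑ t, a t ≤ ∑ _t : Fin p, 1 := Finset.sum_le_sum fun t _ => Nat.lt_succ_iff.1 (hlt t)
    simp at this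
    omega
  have hle : a - Pi.single t 1 ≤ a := fun s => Nat.sub_le _ _
  have hadd : a - Pi.single t 1 + Pi.single t 1 = a := by
    funext s
    by_cases hs : s = t
    · subst hs
      simp
      omega
    · simp [hs]
  refine ⟨a - Pi.single t 1, h.mem_of_le a ha _ hle fun s => ?_, ?_⟩
  · by_cases hs : s = t
    · subst hs
      simp
      omega
    · simpa [hs] using h.one_le a ha s
  · have := congrArg (fun b : Fin p → ℕ => ∑ s, b s) hadd
    simp only [Pi.add_apply, Finset.sum_add_distrib, Finset.sum_pi_single', Finset.mem_univ,
      if_true] at this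
    omega

theorem diagonal_le (h : IsFerrerDiagram p Φ) {N : Fin p → ℕ} (hN : ∀ a ∈ Φ, ∀ k, a k ≤ N k)
    {k : ℕ} (hne : (ferrerDiagonal Φ k).Nonempty) : k ≤ ∑ k, N k := by
  obtain ⟨a, ha, hsum⟩ := hne
  have := Finset.sum_le_sum fun t (_ : t ∈ Finset.univ) => hN a ha t
  have := h.one_le_dim
  omega

theorem numDiagonals_spec (h : IsFerrerDiagram p Φ) {N : Fin p → ℕ}
    (hN : ∀ a ∈ Φ, ∀ k, a k ≤ N k) :
    {k : ℕ | 1 ≤ k ∧ (ferrerDiagonal Φ k).Nonempty} = Set.Icc 1 (numDiagonals Φ) :=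
  Set.eq_Icc_one_ncard (fun _ hk => hk.1) (fun _ hk => h.diagonal_le hN hk.2)
    fun _ hk hk' => ⟨hk, h.ferrerDiagonal_nonempty_of_succ hk hk'.2⟩

theorem fullDiagonals_spec (h : IsFerrerDiagram p Φ) {N : Fin p → ℕ}
    (hN : ∀ a ∈ Φ, ∀ k, a k ≤ N k) :
    {k : ℕ | 1 ≤ k ∧ diagonalCard Φ k = ((k - 1) + (p - 1)).choose (p - 1)} =
      Set.Icc 1 (fullDiagonals Φ) := by
  refine Set.eq_Icc_one_ncard (n := ∑ k, N k) (fun _ hk => hk.1) (fun k hk => ?_)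
    fun k hk hk' => ⟨hk, ?_⟩
  · refine h.diagonal_le hN (Set.nonempty_of_ncard_ne_zero ?_)
    have := hk.2
    rw [diagonalCard] at this
    rw [this]
    exact (Nat.choose_pos (Nat.le_add_left _ _)).ne'
  · obtain ⟨k, rfl⟩ := Nat.exists_eq_add_of_le' hk
    rw [Nat.add_sub_cancel, h.diagonalCard_eq_iff]
    exact h.fullDiagonal_subset_of_succ ((h.diagonalCard_eq_iff _).1 hk'.2)

theorem lt_fullDiagonals_iff (h : IsFerrerDiagram p Φ) {N : Fin p → ℕ}
    (hN : ∀ a ∈ Φ, ∀ k, a k ≤ N k) (k : ℕ) :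
    k < fullDiagonals Φ ↔ fullDiagonal p (k + 1) ⊆ Φ := by
  have := Set.ext_iff.1 (h.fullDiagonals_spec hN) (k + 1)
  rw [← h.diagonalCard_eq_iff]
  simpa [Nat.succ_le_iff] using this.symm

theorem fullDiagonals_le (h : IsFerrerDiagram p Φ) {N : Fin p → ℕ}
    (hN : ∀ a ∈ Φ, ∀ k, a k ≤ N k) : fullDiagonals Φ ≤ ∑ k, N k := by
  obtain hc | hc := Nat.eq_zero_or_pos (fullDiagonals Φ)
  · omega
  · obtain ⟨c, hc'⟩ := Nat.exists_eq_add_of_le' hc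
    have hsub := (h.lt_fullDiagonals_iff hN c).1 (by omega)
    rw [hc']
    refine h.diagonal_le hN (Set.Nonempty.mono (s := fullDiagonal p (c + 1))
      (fun a ha => ⟨hsub ha, ha.2⟩) (Set.nonempty_of_ncard_ne_zero ?_))
    rw [ncard_fullDiagonal h.one_le_dim]
    exact (Nat.choose_pos (Nat.le_add_left _ _)).ne'

end IsFerrerDiagram

/-! ### Sums over boxes, grouped by diagonals -/

section Boxes

variable {p : ℕ} (N : Fin p → ℕ) (Φ : Set (Fin p → ℕ))

open scoped Classical in
/-- The boxes of a diagram, with labels counted from zero and bounded by `N`. -/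
noncomputable def ferrerBoxes : Finset ((k : Fin p) → Fin (N k)) :=
  Finset.univ.filter fun v => (fun k => (v k : ℕ) + 1) ∈ Φ

variable {N Φ}

theorem mem_ferrerBoxes {v : (k : Fin p) → Fin (N k)} :
    v ∈ ferrerBoxes N Φ ↔ (fun k => (v k : ℕ) + 1) ∈ Φ := by
  simp [ferrerBoxes]

theorem ferrerIdeal_eq_boxIdeal (K : Type*) [Field K] :
    ferrerIdeal K N Φ = boxIdeal K (ferrerBoxes N Φ) := by
  rw [ferrerIdeal, boxIdeal]
  congr 1
  ext f
  simp [mem_ferrerBoxes, boxMonomial, eq_comm]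

theorem IsFerrerDiagram.isLowerSet_ferrerBoxes (h : IsFerrerDiagram p Φ) :
    IsLowerSet (ferrerBoxes N Φ : Set ((k : Fin p) → Fin (N k))) := by
  intro v w hwv hv
  exact mem_ferrerBoxes.2 (h.mem_of_le _ (mem_ferrerBoxes.1 hv) _
    (fun k => Nat.succ_le_succ (hwv k)) fun k => Nat.le_add_left _ _)

theorem IsFerrerDiagram.ferrerDiagonal_succ (h : IsFerrerDiagram p Φ)
    (hN : ∀ a ∈ Φ, ∀ k, a k ≤ N k) (k : ℕ) :
    ferrerDiagonal Φ (k + 1) = (fun (v : (k : Fin p) → Fin (N k)) t => (v t : ℕ) + 1) ''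
      ((ferrerBoxes N Φ).filter fun v => ∑ t, (v t : ℕ) = k : Finset _) := by
  have hsum : ∀ v : (k : Fin p) → Fin (N k), ∑ t, ((v t : ℕ) + 1) = ∑ t, (v t : ℕ) + p :=
    fun v => by simp [Finset.sum_add_distrib]
  ext a
  constructor
  · rintro ⟨ha, hk⟩
    have h1 := h.one_le a ha
    let v : (k : Fin p) → Fin (N k) := fun t => ⟨a t - 1, by have := h1 t; have := hN a ha t; omega⟩
    have hv : (fun t => (v t : ℕ) + 1) = a := funext fun t => Nat.sub_add_cancel (h1 t)
    refine ⟨v, Finset.mem_coe.2 (Finset.mem_filter.2 ⟨mem_ferrerBoxes.2 (hv.symm ▸ ha), ?_⟩), hv⟩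
    rw [← hv, hsum] at hk
    omega
  · rintro ⟨v, hv, rfl⟩
    obtain ⟨hv, hk⟩ := Finset.mem_filter.1 (Finset.mem_coe.1 hv)
    refine ⟨mem_ferrerBoxes.1 hv, ?_⟩
    rw [hsum]
    omega

theorem IsFerrerDiagram.diagonalCard_succ (h : IsFerrerDiagram p Φ)
    (hN : ∀ a ∈ Φ, ∀ k, a k ≤ N k) (k : ℕ) :
    diagonalCard Φ (k + 1) =
      ((ferrerBoxes N Φ).filter fun v => ∑ t, (v t : ℕ) = k).card := by
  rw [diagonalCard, h.ferrerDiagonal_succ hN, Set.ncard_image_of_injective, Set.ncard_coe_finset]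
  intro v w hvw
  funext t
  exact Fin.ext (Nat.succ_injective (congrFun hvw t))

theorem IsFerrerDiagram.sum_ferrerBoxes (h : IsFerrerDiagram p Φ)
    (hN : ∀ a ∈ Φ, ∀ k, a k ≤ N k) (g : ℕ → ℕ) :
    ∑ v ∈ ferrerBoxes N Φ, g (∑ t, (v t : ℕ)) =
      ∑ k ∈ Finset.range (∑ t, N t), diagonalCard Φ (k + 1) * g k := by
  have hmaps : ∀ v ∈ ferrerBoxes N Φ, ∑ t, (v t : ℕ) ∈ Finset.range (∑ t, N t) := fun v _ =>
    Finset.mem_range.2 (Finset.sum_lt_sum_of_nonempty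
      ⟨⟨0, h.one_le_dim⟩, Finset.mem_univ _⟩ fun t _ => (v t).isLt)
  rw [← Finset.sum_fiberwise_of_maps_to hmaps]
  refine Finset.sum_congr rfl fun k _ => ?_
  rw [h.diagonalCard_succ hN, ← smul_eq_mul, ← Finset.sum_const]
  exact Finset.sum_congr rfl fun v hv => by rw [(Finset.mem_filter.1 hv).2]

end Boxes

/-! ### Height of the Ferrer ideal -/

section Height

variable {p : ℕ} (K : Type*) [Field K]

/-- The variables `⟨k, i⟩` with `i < t k`. -/
def varsBelow (N t : Fin p → ℕ) : Finset (FerrerVar N) :=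
  Finset.univ.sigma fun k => Finset.univ.filter fun i => (i : ℕ) < t k

theorem mem_varsBelow {N t : Fin p → ℕ} {x : FerrerVar N} :
    x ∈ varsBelow N t ↔ (x.2 : ℕ) < t x.1 := by
  simp [varsBelow]

theorem card_varsBelow (N t : Fin p → ℕ) :
    (varsBelow N t).card = ∑ k, min (N k) (t k) := by
  rw [varsBelow, Finset.card_sigma]
  exact Finset.sum_congr rfl fun k _ => Fin.card_filter_val_lt

variable {Φ : Set (Fin p → ℕ)} {N : Fin p → ℕ}

/-- Let `b` be a box missing from the first non-full diagonal. No box of Φ dominates `b`, so each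
generator involves a variable with label below `b` in its direction; there are at most ∑(b_k - 1) =
c such variables. -/
theorem IsFerrerDiagram.height_le (h : IsFerrerDiagram p Φ) (hN : ∀ a ∈ Φ, ∀ k, a k ≤ N k) :
    (ferrerIdeal K N Φ).height ≤ fullDiagonals Φ := by
  obtain ⟨b, ⟨hb1, hb2⟩, hb⟩ := Set.not_subset.1
    (mt (h.lt_fullDiagonals_iff hN (fullDiagonals Φ)).2 (lt_irrefl _))
  have hle : ferrerIdeal K N Φ ≤ variableIdeal K (varsBelow N fun k => b k - 1) := by
    rw [ferrerIdeal_eq_boxIdeal]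
    refine Ideal.span_le.2 ?_
    rintro _ ⟨v, hv, rfl⟩
    obtain ⟨k, hk⟩ : ∃ k, (v k : ℕ) + 1 < b k := by
      by_contra! hge
      exact hb (h.mem_of_le _ (mem_ferrerBoxes.1 hv) b hge hb1)
    refine Ideal.mem_of_dvd _ (Finset.dvd_prod_of_mem _ (Finset.mem_univ k)) ?_
    exact X_mem_variableIdeal_iff.2 (mem_varsBelow.2 (Nat.lt_sub_of_add_lt hk))
  refine (Ideal.height_mono hle).trans ((height_variableIdeal_le _).trans (Nat.cast_le.2 ?_))
  rw [card_varsBelow]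
  have h1 : ∑ k, min (N k) (b k - 1) ≤ ∑ k, (b k - 1) :=
    Finset.sum_le_sum fun k _ => min_le_right _ _
  have h2 : ∑ k, b k = ∑ k, (b k - 1) + p := by
    rw [← Finset.sum_congr rfl fun t _ => Nat.sub_add_cancel (hb1 t), Finset.sum_add_distrib]
    simp
  omega

theorem IsFerrerDiagram.le_height (h : IsFerrerDiagram p Φ) (hN : ∀ a ∈ Φ, ∀ k, a k ≤ N k) :
    (fullDiagonals Φ : ℕ∞) ≤ (ferrerIdeal K N Φ).height := by
  classical
  rw [Ideal.height_eq_inf_minimalPrimes]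
  refine le_iInf₂ fun J hJ => ?_
  have hJp : J.IsPrime := hJ.1.1
  -- `t k` will be the first label whose variable is not in `J`; if all lie in `J`, the condition is
  -- vacuous at `N k`.
  have hex : ∀ k, ∃ i, ∀ hi : i < N k, (X ⟨k, i, hi⟩ : FerrerRing K N) ∉ J := fun k =>
    ⟨N k, fun hi => absurd hi (lt_irrefl _)⟩
  let t : Fin p → ℕ := fun k => Nat.find (hex k)
  have htN : ∀ k, t k ≤ N k := fun k => Nat.find_min' (hex k) fun hi => absurd hi (lt_irrefl _)
  have ht : (fun k => t k + 1) ∉ Φ := by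
    intro hmem
    have hmem' : boxMonomial K (fun k => ⟨t k, hN _ hmem k⟩ : (k : Fin p) → Fin (N k)) ∈ J := by
      refine hJ.1.2 ?_
      rw [ferrerIdeal_eq_boxIdeal]
      exact Ideal.subset_span ⟨_, mem_ferrerBoxes.2 hmem, rfl⟩
    obtain ⟨k, -, hk⟩ := hJp.prod_mem_iff.1 hmem'
    exact Nat.find_spec (hex k) _ hk
  have hle : variableIdeal K (varsBelow N t) ≤ J := by
    refine Ideal.span_le.2 ?_
    rintro _ ⟨⟨k, i⟩, hi, rfl⟩
    have hi : (i : ℕ) < t k := mem_varsBelow.1 hi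
    have := Nat.find_min (hex k) hi
    push Not at this
    exact this.2
  refine le_trans (Nat.cast_le.2 ?_)
    ((card_le_height_variableIdeal _).trans (Ideal.height_mono hle))
  rw [card_varsBelow, Finset.sum_congr rfl fun k _ => min_eq_right (htN k)]
  -- If ∑ t_k < c, the box (t_k + 1)_k would lie on a full diagonal, hence in Φ.
  by_contra hlt
  refine ht ((h.lt_fullDiagonals_iff hN _).1 (not_le.1 hlt) ⟨fun k => Nat.le_add_left _ _, ?_⟩)
  have : ∑ k, (t k + 1) = ∑ k, t k + p := by simp [Finset.sum_add_distrib]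
  change ∑ k, (t k + 1) + 1 = ∑ k, t k + 1 + p
  omega

theorem IsFerrerDiagram.height_eq (h : IsFerrerDiagram p Φ) (hN : ∀ a ∈ Φ, ∀ k, a k ≤ N k) :
    (ferrerIdeal K N Φ).height = fullDiagonals Φ :=
  (h.height_le K hN).antisymm (h.le_height K hN)

end Height

/-! ### Betti numbers and projective dimension -/

section Betti

variable {p : ℕ} {Φ : Set (Fin p → ℕ)} {N : Fin p → ℕ} (K : Type*) [Field K]

theorem IsFerrerDiagram.exists_resolution (h : IsFerrerDiagram p Φ) :
    ∃ G : MinimalGradedFreeResolution (ferrerIdeal K N Φ),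
      ∀ j, G.rank (j + 1) = ∑ v ∈ ferrerBoxes N Φ, (∑ k, (v k : ℕ)).choose j := by
  obtain ⟨F, hF⟩ := exists_linearResolution_boxIdeal K _ (h.isLowerSet_ferrerBoxes (N := N))
  rw [ferrerIdeal_eq_boxIdeal]
  obtain ⟨G, hG⟩ := F.exists_minimalGradedFreeResolution h.one_le_dim
  exact ⟨G, fun j => (hG j).trans (hF j)⟩

theorem IsFerrerDiagram.sum_choose_eq (h : IsFerrerDiagram p Φ) (hN : ∀ a ∈ Φ, ∀ k, a k ≤ N k)
    {d : ℕ} (hd : ∑ k, N k = fullDiagonals Φ + d) {s : ℕ → ℕ}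
    (hs : ∀ i, 1 ≤ i → i ≤ d → s (d - i) = diagonalCard Φ (fullDiagonals Φ + i)) (j : ℕ) :
    ∑ v ∈ ferrerBoxes N Φ, (∑ k, (v k : ℕ)).choose j =
      (fullDiagonals Φ + p - 1).choose (j + 1 + p - 1) * (j + 1 + p - 2).choose (p - 1) +
        ∑ i ∈ Finset.range d, s i * (fullDiagonals Φ + d - i - 1).choose j := by
  rw [h.sum_ferrerBoxes hN fun k => k.choose j, hd, Finset.sum_range_add]
  obtain ⟨P, rfl⟩ := Nat.exists_eq_add_of_le' h.one_le_dim
  congr 1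
  · have hk : ∀ k ∈ Finset.range (fullDiagonals Φ),
        diagonalCard Φ (k + 1) * k.choose j = (k + P).choose P * k.choose j := by
      intro k hk
      rw [(h.diagonalCard_eq_iff k).2
        ((h.lt_fullDiagonals_iff hN k).1 (Finset.mem_range.1 hk)), Nat.add_sub_cancel]
    rw [Finset.sum_congr rfl hk, Nat.sum_range_choose_mul_choose,
      show j + 1 + (P + 1) - 2 = j + P by omega, show j + 1 + (P + 1) - 1 = j + P + 1 by omega]
    rfl
  -- `s i` counts the diagonal c + d - i, whose boxes have |v| = c + d - i - 1; the summation order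
  -- is therefore reversed.
  · rw [← Finset.sum_range_reflect]
    refine Finset.sum_congr rfl fun i hi => ?_
    have hi := Finset.mem_range.1 hi
    have := hs (d - i) (by omega) (by omega)
    rw [show d - (d - i) = i by omega] at this
    rw [this, show fullDiagonals Φ + (d - 1 - i) + 1 = fullDiagonals Φ + (d - i) by omega,
      show fullDiagonals Φ + (d - 1 - i) = fullDiagonals Φ + d - i - 1 by omega]

theorem IsFerrerDiagram.projectiveDimension_eq (h : IsFerrerDiagram p Φ)
    (hN : ∀ a ∈ Φ, ∀ k, a k ≤ N k) :
    CategoryTheory.projectiveDimension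
      (ModuleCat.of (FerrerRing K N) (FerrerRing K N ⧸ ferrerIdeal K N Φ)) =
        (numDiagonals Φ : WithBot ℕ∞) := by
  obtain ⟨G, hG⟩ := h.exists_resolution (N := N) K
  have hspec : ∀ k, (ferrerDiagonal Φ (k + 1)).Nonempty ↔ k < numDiagonals Φ := fun k => by
    simpa [Nat.succ_le_iff] using Set.ext_iff.1 (h.numDiagonals_spec hN) (k + 1)
  have hlt : ∀ v ∈ ferrerBoxes N Φ, ∑ k, (v k : ℕ) < numDiagonals Φ := fun v hv => by
    rw [← hspec, h.ferrerDiagonal_succ hN]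
    exact ⟨_, v, Finset.mem_coe.2 (Finset.mem_filter.2 ⟨hv, rfl⟩), rfl⟩
  have hrank : G.rank (numDiagonals Φ + 1) = 0 := by
    rw [hG]
    exact Finset.sum_eq_zero fun v hv => Nat.choose_eq_zero_of_lt (hlt v hv)
  -- A box on the last nonempty diagonal e + 1 contributes C(e, e) = 1.
  have hrank' : G.rank (numDiagonals Φ) ≠ 0 := by
    obtain ⟨e, he⟩ : ∃ e, numDiagonals Φ = e + 1 := by
      refine Nat.exists_eq_succ_of_ne_zero fun h0 => ?_
      obtain ⟨a, ha⟩ := h.nonempty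
      have hsum : ∑ t, a t = ∑ t, (a t - 1) + p := by
        rw [← Finset.sum_congr rfl fun t _ => Nat.sub_add_cancel (h.one_le a ha t),
          Finset.sum_add_distrib]
        simp
      have := (hspec (∑ t, (a t - 1))).1 ⟨a, ha, by omega⟩
      omega
    have hne := (hspec e).2 (by omega)
    rw [h.ferrerDiagonal_succ hN, Set.image_nonempty] at hne
    obtain ⟨v, hv⟩ := hne
    obtain ⟨hv, hsum⟩ := Finset.mem_filter.1 (Finset.mem_coe.1 hv)
    rw [he, hG]
    intro h0
    have := Finset.sum_eq_zero_iff.1 h0 v hv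
    rw [hsum, Nat.choose_self] at this
    exact one_ne_zero this
  refine le_antisymm ?_ ?_
  · rw [CategoryTheory.projectiveDimension_le_iff]
    exact hasProjectiveDimensionLT_of_rank_eq_zero _ G.aug_surjective G.exact_aug G.exact_d hrank
  · rw [CategoryTheory.projectiveDimension_ge_iff]
    exact fun hlt => hrank' (rank_eq_zero_of_hasProjectiveDimensionLT constantCoeff _
      G.aug_surjective G.exact_aug G.exact_d G.d_map_constantCoeff hlt)

end Betti

theorem mainTheorem1 {K : Type*} [Field K] {p : ℕ} (Φ : Set (Fin p → ℕ))
    (hΦ : IsFerrerDiagram p Φ) (N : Fin p → ℕ) (hN : ∀ a ∈ Φ, ∀ k, a k ≤ N k)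
    (n : ℕ) (hn : n = ∑ k, N k) :
    ∃ c d : ℕ, (ferrerIdeal K N Φ).height = c ∧ n = c + d ∧
      c = fullDiagonals Φ ∧
      (∀ s : ℕ → ℕ, (∀ i, 1 ≤ i → i ≤ d → s (d - i) = diagonalCard Φ (c + i)) →
        ∀ j, 1 ≤ j → IsBettiNumber (ferrerIdeal K N Φ) j
          ((c + p - 1).choose (j + p - 1) * (j + p - 2).choose (p - 1) +
            ∑ i ∈ Finset.range d, s i * (n - i - 1).choose (j - 1))) ∧
      CategoryTheory.projectiveDimension
        (ModuleCat.of (FerrerRing K N) (FerrerRing K N ⧸ ferrerIdeal K N Φ)) =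
          (numDiagonals Φ : WithBot ℕ∞) := by
  obtain ⟨d, hd⟩ := Nat.exists_eq_add_of_le (hΦ.fullDiagonals_le hN)
  refine ⟨fullDiagonals Φ, d, hΦ.height_eq K hN, hn.trans hd, rfl, fun s hs j hj => ?_,
    hΦ.projectiveDimension_eq K hN⟩
  obtain ⟨j, rfl⟩ := Nat.exists_eq_add_of_le' hj
  obtain ⟨G, hG⟩ := hΦ.exists_resolution (N := N) K
  refine ⟨⟨G⟩, fun F => ?_⟩
  rw [F.rank_eq G, hG, hΦ.sum_choose_eq hN hd hs, hn, hd, Nat.add_sub_cancel]
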